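/- Let $\mathcal A$ be a unital $C^*$-algebra, let $M$ be an arbitrary Hilbert $\mathcal A$-module, and let $F$ be a bounded, $\mathcal A$-linear, adjointable operator on $M$. An $\mathcal A$-Fredholm decomposition for $F$ consists of closed submodules $M_1,N_1,M_2,N_2$ of $M$ such that $M=M_1+N_1=M_2+N_2$, $M_1\cap N_1=M_2\cap N_2=\{0\}$ (orthogonality is not required), $F$ restricts to an isomorphism of $M_1$ onto $M_2$, $F(N_1)\subseteq N_2$, and $N_1,N_2$ are finitely generated; $F$ is called $\mathcal A$-Fredholm if such a decomposition exists. Let $K_0(\mathcal A)$ be the Grothendieck group of the abelian monoid of isomorphism classes of finitely generated projective $\mathcal A$-modules under direct sum. Suppose that $F$ is $\mathcal A$-Fredholm and that its image $\operatorname{Im}F$ is closed. Then $\ker F$ and $(\operatorname{Im}F)^{\perp}$ are finitely generated projective $\mathcal A$-modules, and for every $\mathcal A$-Fredholm decomposition $M_1,N_1,M_2,N_2$ for $F$ the modules $N_1,N_2$ are finitely generated projective and $$[N_1]-[N_2]=[\ker F]-[(\operatorname{Im}F)^{\perp}]\quad\text{in } K_0(\mathcal A).$$ Consequently $\operatorname{index}F:=[N_1]-[N_2]$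 does not depend on the choice of the $\mathcal A$-Fredholm decomposition, i.e. the index of $F$ is well defined, and $\operatorname{index}F=[\ker F]-[(\operatorname{Im}F)^{\perp}]$. -/

import Mathlib

universe u v

/-! ### The group `K₀` of a ring -/

/-- `N` is a finitely generated projective `A`-module. -/
structure IsFGProjective (A : Type u) [Ring A] (N : Type v) [AddCommGroup N] [Module A N] :
    Prop where
  finite : Module.Finite A N
  projective : Module.Projective A N

/-- An object of the category of finitely generated projective `A`-modules. -/
structure FGProj (A : Type u) [Ring A] where
  carrier : Type u
  [addCommGroup : AddCommGroup carrier]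
  [module : Module A carrier]
  isFGProjective : IsFGProjective A carrier

attribute [instance] FGProj.addCommGroup FGProj.module

/-- Isomorphism of finitely generated projective `A`-modules. -/
instance FGProj.setoid (A : Type u) [Ring A] : Setoid (FGProj A) where
  r P Q := Nonempty (P.carrier ≃ₗ[A] Q.carrier)
  iseqv :=
    { refl := fun P => ⟨LinearEquiv.refl A P.carrier⟩
      symm := fun ⟨e⟩ => ⟨e.symm⟩
      trans := fun ⟨e⟩ ⟨f⟩ => ⟨e.trans f⟩ }

/-- The zero module. -/
def FGProj.zero (A : Type u) [Ring A] : FGProj A where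
  carrier := PUnit.{u + 1}
  isFGProjective := ⟨inferInstance, inferInstance⟩

/-- The direct sum of two finitely generated projective modules. -/
def FGProj.sum {A : Type u} [Ring A] (P Q : FGProj A) : FGProj A where
  carrier := P.carrier × Q.carrier
  isFGProjective := by
    have := P.isFGProjective.finite
    have := Q.isFGProjective.finite
    have := P.isFGProjective.projective
    have := Q.isFGProjective.projective
    exact ⟨inferInstance, inferInstance⟩

/-- The set of isomorphism classes of finitely generated projective `A`-modules. -/
def FGProjClass (A : Type u) [Ring A] : Type (u + 1) := Quotient (FGProj.setoid A)

/-- The isomorphism class of a finitely generated projective module. -/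
def FGProjClass.mk {A : Type u} [Ring A] (P : FGProj A) : FGProjClass A :=
  Quotient.mk (FGProj.setoid A) P

instance FGProjClass.instZero (A : Type u) [Ring A] : Zero (FGProjClass A) :=
  ⟨FGProjClass.mk (FGProj.zero A)⟩

instance FGProjClass.instAdd (A : Type u) [Ring A] : Add (FGProjClass A) :=
  ⟨Quotient.map₂ FGProj.sum (fun _ _ ⟨e⟩ _ _ ⟨f⟩ => ⟨LinearEquiv.prodCongr e f⟩)⟩

/-- Isomorphism classes form an abelian monoid under `[P] + [Q] = [P ⊕ Q]`. -/
instance FGProjClass.addCommMonoid (A : Type u) [Ring A] : AddCommMonoid (FGProjClass A) where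
  add_assoc := by
    rintro ⟨P⟩ ⟨Q⟩ ⟨R⟩
    exact Quotient.sound ⟨LinearEquiv.prodAssoc A P.carrier Q.carrier R.carrier⟩
  zero_add := by
    rintro ⟨P⟩
    exact Quotient.sound ⟨(LinearEquiv.uniqueProd : (PUnit.{u + 1} × P.carrier) ≃ₗ[A] P.carrier)⟩
  add_zero := by
    rintro ⟨P⟩
    exact Quotient.sound ⟨(LinearEquiv.prodUnique : (P.carrier × PUnit.{u + 1}) ≃ₗ[A] P.carrier)⟩
  add_comm := by
    rintro ⟨P⟩ ⟨Q⟩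
    exact Quotient.sound ⟨LinearEquiv.prodComm A P.carrier Q.carrier⟩
  nsmul := nsmulRec

/-- `K₀(A)`: the Grothendieck group (symmetrization) of the monoid of isomorphism classes of
finitely generated projective `A`-modules. -/
abbrev KZero (A : Type u) [Ring A] : Type (u + 1) :=
  Algebra.GrothendieckAddGroup (FGProjClass A)

/-- A copy, in the universe of `A`, of a finitely generated projective `A`-module `N` that may live
in another universe. -/
noncomputable def IsFGProjective.toFGProj {A : Type u} [Ring A] {N : Type v} [AddCommGroup N]
    [Module A N] (h : IsFGProjective A N) : FGProj A :=
  haveI := h.finite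
  haveI := h.projective
  { carrier := Module.Finite.repr A N
    isFGProjective :=
      ⟨Module.Finite.equiv (Module.Finite.reprEquiv A N).symm,
        Module.Projective.of_equiv (Module.Finite.reprEquiv A N).symm⟩ }

/-- The class `[N] ∈ K₀(A)` of a finitely generated projective `A`-module `N`. -/
noncomputable def IsFGProjective.kClass {A : Type u} [Ring A] {N : Type v} [AddCommGroup N]
    [Module A N] (h : IsFGProjective A N) : KZero A :=
  Algebra.GrothendieckAddGroup.of (FGProjClass.mk h.toFGProj)

/-! ### Fredholm operators on Hilbert C⋆-modules -/

section Hilbert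

variable {A : Type u} [CStarAlgebra A] [PartialOrder A] [StarOrderedRing A]
  {M : Type v} [NormedAddCommGroup M] [NormedSpace ℂ M] [Module A M] [CStarModule A M]

/-- The orthogonal complement of a submodule for the `A`-valued inner product. -/
def hilbertOrthogonal (N : Submodule A M) : Submodule A M where
  carrier := {y | ∀ x ∈ N, inner A x y = 0}
  add_mem' := by
    intro y z hy hz x hx
    rw [CStarModule.inner_add_right, hy x hx, hz x hx, add_zero]
  zero_mem' := fun _ _ => CStarModule.inner_zero_right
  smul_mem' := by
    intro a y hy x hx
    rw [CStarModule.inner_op_smul_right, hy x hx, mul_zero]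

/-- A bounded `A`-linear operator is adjointable if it has an adjoint with respect to the
`A`-valued inner product. -/
def IsAdjointable (F : M →L[A] M) : Prop :=
  ∃ G : M →L[A] M, ∀ x y : M, inner A (F x) y = inner A x (G y)

/-- `M = M₁ ⊕̃ N₁ → M₂ ⊕̃ N₂ = M` is an `A`-Fredholm decomposition for `F`: both are (not
necessarily orthogonal) direct sum decompositions into closed submodules, `F` restricts to an
isomorphism `M₁ → M₂`, `F` maps `N₁` into `N₂`, and `N₁`, `N₂` are finitely generated. -/
structure IsFredholmDecomposition (F : M →L[A] M) (M₁ N₁ M₂ N₂ : Submodule A M) : Prop where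
  isClosed_M₁ : IsClosed (M₁ : Set M)
  isClosed_N₁ : IsClosed (N₁ : Set M)
  isClosed_M₂ : IsClosed (M₂ : Set M)
  isClosed_N₂ : IsClosed (N₂ : Set M)
  isCompl_domain : IsCompl M₁ N₁
  isCompl_codomain : IsCompl M₂ N₂
  isomorphism : ∃ F₁ : M₁ ≃L[A] M₂, ∀ x : M₁, (F₁ x : M) = F x
  mapsTo : ∀ x ∈ N₁, F x ∈ N₂
  fg_N₁ : N₁.FG
  fg_N₂ : N₂.FG

/-- `F` is an `A`-Fredholm operator on `M`. -/
def IsAFredholm (F : M →L[A] M) : Prop :=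
  IsAdjointable F ∧ ∃ M₁ N₁ M₂ N₂ : Submodule A M, IsFredholmDecomposition F M₁ N₁ M₂ N₂

/-- `κ` is a value of the index of `F`, that is, `κ = [N₁] - [N₂]` for some `A`-Fredholm
decomposition of `F`. -/
def IsFredholmIndex (F : M →L[A] M) (κ : KZero A) : Prop :=
  ∃ M₁ N₁ M₂ N₂ : Submodule A M, IsFredholmDecomposition F M₁ N₁ M₂ N₂ ∧
    ∃ (h₁ : IsFGProjective A N₁) (h₂ : IsFGProjective A N₂), κ = h₁.kClass - h₂.kClass

end Hilbert

/-! ### Adjointable operators with closed range. -/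

section Adjoint

variable {A : Type*} [CStarAlgebra A] [PartialOrder A]
  {E : Type*} [NormedAddCommGroup E] [NormedSpace ℂ E] [Module A E] [CStarModule A E]
  {M : Type*} [NormedAddCommGroup M] [NormedSpace ℂ M] [Module A M] [CStarModule A M]

/-! Put `C = (Im F)ᗮ`. In any decomposition `ker F ≤ N₁` and `M₂ ≤ Im F`. Projection along `Im F`
therefore maps `N₂` onto `C` with kernel `N₂ ∩ Im F`, and `F` maps `N₁` onto `N₂ ∩ Im F` with kernel
`ker F`. When all terms are projective both sequences split, and subtracting classes cancels `[N₂ ∩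
Im F]`; what remains does not mention the decomposition. The analytic input is
`exists_mem_range_apply_adjoint_eq`: for adjointable `T` with closed range, `T T'` is onto `range
T`. With `T = F` it gives `M = Im F ⊕ C`; with `T : Aⁿ → M` it shows that a closed finitely
generated submodule is projective. -/

/-- An operator `S` for which `S + t` is bounded below, uniformly in `t ≥ 0`, is invertible. -/
theorem ContinuousLinearMap.isUnit_of_forall_le_norm_add_smul {K : Type*} [NormedAddCommGroup K]
    [NormedSpace ℂ K] [CompleteSpace K] (S : K →L[ℂ] K) {c : ℝ} (hc : 0 < c)
    (hS : ∀ t : ℝ, 0 ≤ t → ∀ x, c * ‖x‖ ≤ ‖S x + (t : ℂ) • x‖) : IsUnit S := by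
  -- Continuity method: the lower bound at `t` gives an inverse of norm at most `c⁻¹`, so a Neumann
  -- series covers every parameter within distance `c`.
  have step : ∀ t s : ℝ, 0 ≤ t → |t - s| < c → IsUnit (S + (t : ℂ) • (1 : K →L[ℂ] K)) →
      IsUnit (S + (s : ℂ) • (1 : K →L[ℂ] K)) := by
    rintro t s ht hts ⟨U, hU⟩
    have hinv : ‖(↑U⁻¹ : K →L[ℂ] K)‖ ≤ c⁻¹ := by
      refine ContinuousLinearMap.opNorm_le_bound _ (by positivity) fun x => ?_
      have h1 := hS t ht ((↑U⁻¹ : K →L[ℂ] K) x)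
      have h2 : (U : K →L[ℂ] K) ((↑U⁻¹ : K →L[ℂ] K) x) = x := by
        rw [← mul_apply_eq_comp, U.mul_inv, one_apply_eq_self]
      rw [hU] at h2
      simp only [add_apply, smul_apply,
        one_apply_eq_self] at h2
      rw [h2] at h1
      rw [inv_mul_eq_div, le_div_iff₀ hc]
      linarith
    have hlt : ‖((t - s : ℝ) : ℂ) • (↑U⁻¹ : K →L[ℂ] K)‖ < 1 := by
      rw [norm_smul, Complex.norm_real, Real.norm_eq_abs]
      calc |t - s| * ‖(↑U⁻¹ : K →L[ℂ] K)‖ ≤ |t - s| * c⁻¹ := by gcongr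
        _ < c * c⁻¹ := by gcongr
        _ = 1 := mul_inv_cancel₀ hc.ne'
    have h := U.isUnit.mul (isUnit_one_sub_of_norm_lt_one hlt)
    rw [mul_sub, mul_one, mul_smul_comm, U.mul_inv, hU] at h
    convert h using 1
    rw [Complex.ofReal_sub, sub_smul]
    abel
  have large : IsUnit (S + ((‖S‖ + 1 : ℝ) : ℂ) • (1 : K →L[ℂ] K)) := by
    have h0 : (0 : ℝ) < ‖S‖ + 1 := by positivity
    have h0' : ((‖S‖ + 1 : ℝ) : ℂ) ≠ 0 := by exact_mod_cast h0.ne'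
    have hlt : ‖-(((‖S‖ + 1 : ℝ) : ℂ)⁻¹ • S)‖ < 1 := by
      rw [norm_neg, norm_smul, norm_inv, Complex.norm_real, Real.norm_eq_abs, abs_of_pos h0,
        inv_mul_lt_one₀ h0]
      linarith
    have h := ((IsUnit.mk0 _ h0').map (algebraMap ℂ (K →L[ℂ] K))).mul
      (isUnit_one_sub_of_norm_lt_one hlt)
    rw [Algebra.algebraMap_eq_smul_one, smul_mul_assoc, one_mul, sub_neg_eq_add, smul_add,
      smul_smul, mul_inv_cancel₀ h0', one_smul, add_comm] at h
    exact h
  -- Descend from `‖S‖ + 1` to `0` in `n` equal steps, each shorter than `c`.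
  obtain ⟨n, hn⟩ := exists_nat_gt ((‖S‖ + 1) / c)
  have hn0 : (0 : ℝ) < n := lt_of_le_of_lt (by positivity) hn
  have hd : (‖S‖ + 1) / n < c := by
    rw [div_lt_iff₀ hn0]; rw [div_lt_iff₀ hc] at hn; linarith
  have all : ∀ k : ℕ, k ≤ n →
      IsUnit (S + (((n - k : ℝ) * ((‖S‖ + 1) / n) : ℝ) : ℂ) • (1 : K →L[ℂ] K)) := by
    intro k
    induction k with
    | zero =>
      intro _
      rw [Nat.cast_zero, sub_zero, mul_div_cancel₀ _ hn0.ne']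
      exact large
    | succ k ih =>
      intro hk
      have hk' : (k : ℝ) ≤ n := by exact_mod_cast (Nat.le_succ k).trans hk
      refine step _ _ (mul_nonneg (by linarith) (by positivity)) ?_ (ih (by omega))
      rw [← sub_mul, Nat.cast_succ]
      ring_nf
      ring_nf at hd
      rw [abs_of_nonneg (by positivity)]
      exact hd
  simpa using all n le_rfl

variable {T : E →ₗ[A] M} {T' : M →ₗ[A] E}

namespace CStarModule

variable (A) in
theorem ext_inner_left {x y : M} (h : ∀ w : M, inner A w x = inner A w y) : x = y := by
  rw [← sub_eq_zero, ← inner_self (A := A), inner_sub_right, h, sub_self]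

theorem adjoint_symm (hT : ∀ x y, inner A (T x) y = inner A x (T' y)) (y : M) (x : E) :
    inner A (T' y) x = inner A y (T x) := by
  rw [← star_inner, ← hT, star_inner]

/-- By adjointness `⟨T'y, T'y⟩ = ⟨y, T T'y⟩`. Hence `T` is injective on the range of `T'`. -/
theorem adjoint_apply_eq_zero (hT : ∀ x y, inner A (T x) y = inner A x (T' y)) {y : M}
    (h : T (T' y) = 0) : T' y = 0 := by
  rw [← inner_self (A := A), adjoint_symm hT, h, inner_zero_right]

/-- An adjointable operator between Hilbert modules is automatically complex linear. -/
def complexLinear (T : E →ₗ[A] M) (T' : M →ₗ[A] E)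
    (hT : ∀ x y, inner A (T x) y = inner A x (T' y)) : E →ₗ[ℂ] M where
  toFun := T
  map_add' := T.map_add
  map_smul' c x := ext_inner_left A fun w => by
    rw [← adjoint_symm hT, RingHom.id_apply, inner_smul_right_complex, inner_smul_right_complex,
      adjoint_symm hT]

variable [StarOrderedRing A]

/-- An adjointable operator between Hilbert modules is automatically bounded. -/
noncomputable def continuousComplexLinear [CompleteSpace E] [CompleteSpace M]
    (T : E →ₗ[A] M) (T' : M →ₗ[A] E)
    (hT : ∀ x y, inner A (T x) y = inner A x (T' y)) : E →L[ℂ] M where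
  __ := complexLinear T T' hT
  -- Closed graph theorem: pairing with `w` moves `T` to `T' w`, where the limit can be taken.
  cont := (complexLinear T T' hT).continuous_of_seq_closed_graph fun u x y hu hTu =>
    ext_inner_left A fun w => by
      have h1 : Filter.Tendsto (fun n => inner A w (T (u n))) Filter.atTop (nhds (inner A w y)) :=
        ((continuous_inner (A := A) (E := M)).comp
          (Continuous.prodMk_right w)).continuousAt.tendsto.comp hTu
      have h2 : Filter.Tendsto (fun n => inner A (T' w) (u n)) Filter.atTop
          (nhds (inner A (T' w) x)) :=
        ((continuous_inner (A := A) (E := E)).comp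
          (Continuous.prodMk_right (T' w))).continuousAt.tendsto.comp hu
      simp only [adjoint_symm hT] at h2
      exact tendsto_nhds_unique h1 h2

theorem le_norm_of_sq_le_norm_inner {x y : M} {c : ℝ}
    (h : c * ‖x‖ ^ 2 ≤ ‖inner A x y‖) : c * ‖x‖ ≤ ‖y‖ := by
  rcases eq_or_ne x 0 with rfl | hx
  · simp
  · have hx' := norm_pos_iff.mpr hx
    have := h.trans (norm_inner_le M)
    nlinarith

/-- If `T` has closed range, then `T T'` maps the range of `T` onto itself. -/
theorem exists_mem_range_apply_adjoint_eq [CompleteSpace E] [CompleteSpace M]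
    (hT : ∀ x y, inner A (T x) y = inner A x (T' y)) (hclosed : IsClosed (Set.range T)) (x : E) :
    ∃ z, T (T' (T z)) = T x := by
  let TC : E →L[ℂ] M := continuousComplexLinear T T' hT
  let TC' : M →L[ℂ] E := continuousComplexLinear T' T (adjoint_symm hT)
  let K : Submodule ℂ M := TC.toLinearMap.range
  have hK : IsClosed (K : Set M) := hclosed
  have : CompleteSpace K := hK.completeSpace_coe
  let P : E →L[ℂ] K := TC.codRestrict K fun x => ⟨x, rfl⟩
  have hP : Function.Surjective P := by
    rintro ⟨_, x, rfl⟩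
    exact ⟨x, rfl⟩
  -- The open mapping constant of `T` onto its range becomes, by duality, a lower bound `C⁻¹` for
  -- `T'` there: if `T x = k`, then `‖k‖² = ‖⟨T'k, x⟩‖ ≤ ‖T'k‖ ‖x‖`.
  obtain ⟨C, hC, hpre⟩ := P.exists_preimage_norm_le hP
  have hT'below : ∀ k : K, C⁻¹ * ‖k‖ ≤ ‖T' (k : M)‖ := by
    intro k
    obtain ⟨x, hx, hxk⟩ := hpre k
    have hxk' : T x = (k : M) := congrArg Subtype.val hx
    have h1 : ‖(k : M)‖ ^ 2 ≤ ‖T' (k : M)‖ * ‖x‖ := by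
      rw [norm_sq_eq A]
      conv_lhs => rw [← hxk', ← adjoint_symm hT, hxk']
      exact norm_inner_le E
    have h2 : ‖k‖ = ‖(k : M)‖ := rfl
    rw [inv_mul_le_iff₀ hC]
    rcases (norm_nonneg k).eq_or_lt with h0 | h0
    · rw [← h0]; positivity
    · rw [← h2] at h1
      have : ‖T' (k : M)‖ * ‖x‖ ≤ ‖T' (k : M)‖ * (C * ‖k‖) := by gcongr
      nlinarith
  let S : K →L[ℂ] K := P.comp (TC'.comp K.subtypeL)
  have hS : IsUnit S := by
    -- In `A`, `⟨k, (S + t)k⟩ = ⟨T'k, T'k⟩ + t⟨k, k⟩ ≥ ⟨T'k, T'k⟩`, whose norm is at least `C⁻²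
    -- ‖k‖²`, uniformly in `t ≥ 0`.
    refine S.isUnit_of_forall_le_norm_add_smul (c := (C⁻¹) ^ 2) (by positivity) fun t ht k => ?_
    change _ * ‖(k : M)‖ ≤ ‖T (T' (k : M)) + (t : ℂ) • (k : M)‖
    refine le_norm_of_sq_le_norm_inner (A := A) ?_
    have h1 : inner A (k : M) (T (T' (k : M)) + (t : ℂ) • (k : M)) =
        inner A (T' (k : M)) (T' (k : M)) + t • inner A (k : M) (k : M) := by
      rw [inner_add_right, ← adjoint_symm hT, inner_smul_right_complex, Complex.coe_smul]
    rw [h1, ← mul_pow]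
    calc (C⁻¹ * ‖k‖) ^ 2 ≤ ‖T' (k : M)‖ ^ 2 := by gcongr; exact hT'below k
      _ = ‖inner A (T' (k : M)) (T' (k : M))‖ := norm_sq_eq A
      _ ≤ _ := by
        refine CStarAlgebra.norm_le_norm_of_nonneg_of_le inner_self_nonneg ?_
        exact le_add_of_nonneg_right (smul_nonneg ht inner_self_nonneg)
  obtain ⟨U, hU⟩ := hS
  obtain ⟨z, hz⟩ := hP ((↑U⁻¹ : K →L[ℂ] K) (P x))
  refine ⟨z, ?_⟩
  have h : S (P z) = P x := by
    rw [hz, ← hU, ← mul_apply_eq_comp, U.mul_inv, one_apply_eq_self]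
  exact congrArg Subtype.val h

/-- The range of an adjointable operator is orthogonally complemented if it is closed. -/
theorem isCompl_range_hilbertOrthogonal [CompleteSpace E] [CompleteSpace M]
    (hT : ∀ x y, inner A (T x) y = inner A x (T' y)) (hclosed : IsClosed (Set.range T)) :
    IsCompl (LinearMap.range T) (hilbertOrthogonal (LinearMap.range T)) := by
  constructor
  · rw [Submodule.disjoint_def]
    intro x hx hx'
    exact inner_self.mp (hx' x hx)
  · rw [codisjoint_iff, Submodule.eq_top_iff']
    intro y
    -- With `T T' T z = T T' y`, the vector `y - T z` lies in `ker T'`, hence is orthogonal to the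
    -- range.
    obtain ⟨z, hz⟩ := exists_mem_range_apply_adjoint_eq hT hclosed (T' y)
    have h0 : T' (y - T z) = 0 :=
      adjoint_apply_eq_zero hT (by rw [map_sub, map_sub, hz, sub_self])
    rw [Submodule.mem_sup]
    refine ⟨T z, ⟨z, rfl⟩, y - T z, ?_, by abel⟩
    rintro _ ⟨x, rfl⟩
    rw [hT, h0, inner_zero_right]

/-- An adjointable operator with closed range has a linear section over its range. -/
theorem exists_section_of_isClosed_range [CompleteSpace E] [CompleteSpace M]
    (hT : ∀ x y, inner A (T x) y = inner A x (T' y)) (hclosed : IsClosed (Set.range T)) :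
    ∃ s : LinearMap.range T →ₗ[A] E, ∀ y, T (s y) = y := by
  -- `T` restricts to a bijection from `range T'` to `range T`; its inverse is the section.
  let g : LinearMap.range T' →ₗ[A] LinearMap.range T :=
    T.rangeRestrict.comp (LinearMap.range T').subtype
  have hg : Function.Bijective g := by
    constructor
    · rw [injective_iff_map_eq_zero]
      rintro ⟨_, y, rfl⟩ h
      exact Subtype.ext (adjoint_apply_eq_zero hT (congrArg Subtype.val h))
    · rintro ⟨_, x, rfl⟩
      obtain ⟨z, hz⟩ := exists_mem_range_apply_adjoint_eq hT hclosed x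
      exact ⟨⟨T' (T z), ⟨T z, rfl⟩⟩, Subtype.ext hz⟩
  let e := LinearEquiv.ofBijective g hg
  refine ⟨(LinearMap.range T').subtype.comp e.symm.toLinearMap, fun y => ?_⟩
  exact congrArg Subtype.val (e.apply_symm_apply y)

end CStarModule

variable [StarOrderedRing A]

theorem IsFGProjective.of_retract {R : Type*} [Ring R] {N P : Type*} [AddCommGroup N] [Module R N]
    [AddCommGroup P] [Module R P] (hP : IsFGProjective R P) (i : N →ₗ[R] P) (s : P →ₗ[R] N)
    (h : ∀ x, s (i x) = x) : IsFGProjective R N :=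
  have := hP.finite
  have := hP.projective
  ⟨Module.Finite.of_surjective s fun x => ⟨i x, h x⟩,
    Module.Projective.of_split i s (LinearMap.ext h)⟩

open scoped WithCStarModule in
/-- A closed finitely generated submodule of a Hilbert module is projective. -/
theorem Submodule.FG.isFGProjective_of_isClosed [CompleteSpace M] {N : Submodule A M} (hfg : N.FG)
    (hN : IsClosed (N : Set M)) : IsFGProjective A N := by
  obtain ⟨n, s, rfl⟩ := Submodule.fg_iff_exists_fin_generating_family.mp hfg
  -- The generators `s` present the submodule as the range of `T : Aⁿ → M`, with adjoint `y ↦ (⟨sᵢ,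
  -- y⟩)ᵢ`.
  let e := WithCStarModule.linearEquiv A A (Fin n → A)
  let T : C⋆ᵐᵒᵈ(A, Fin n → A) →ₗ[A] M := (Fintype.linearCombination A s).comp e.toLinearMap
  let T' : M →ₗ[A] C⋆ᵐᵒᵈ(A, Fin n → A) := e.symm.toLinearMap.comp (LinearMap.pi fun i =>
    { toFun := fun y => inner A (s i) y
      map_add' := fun _ _ => CStarModule.inner_add_right
      map_smul' := fun _ _ => CStarModule.inner_op_smul_right })
  have hT : ∀ x y, inner A (T x) y = inner A x (T' y) := by
    intro x y
    simp [T, T', e, WithCStarModule.pi_inner, Fintype.linearCombination_apply,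
      WithCStarModule.inner_def]
  have hrange : LinearMap.range T = Submodule.span A (Set.range s) := by
    rw [LinearMap.range_comp_of_range_eq_top _ e.range, Fintype.range_linearCombination]
  rw [← hrange] at hN ⊢
  obtain ⟨σ, hσ⟩ := CStarModule.exists_section_of_isClosed_range hT hN
  have hfree : IsFGProjective A C⋆ᵐᵒᵈ(A, Fin n → A) :=
    ⟨Module.Finite.equiv e.symm, Module.Projective.of_equiv e.symm⟩
  exact hfree.of_retract σ T.rangeRestrict fun y => Subtype.ext (hσ y)

end Adjoint

/-! ### Additivity of classes in `K₀`. -/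

section KTheory

variable {R : Type u} [Ring R] {N P Q : Type*} [AddCommGroup N] [Module R N]
  [AddCommGroup P] [Module R P] [AddCommGroup Q] [Module R Q]

/-- The identification of `h.toFGProj` with the module it copies. -/
noncomputable def IsFGProjective.toFGProjEquiv (h : IsFGProjective R N) :
    h.toFGProj.carrier ≃ₗ[R] N :=
  haveI := h.finite
  Module.Finite.reprEquiv R N

theorem IsFGProjective.kClass_congr (hN : IsFGProjective R N) (hP : IsFGProjective R P)
    (e : N ≃ₗ[R] P) : hN.kClass = hP.kClass :=
  congrArg Algebra.GrothendieckAddGroup.of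
    (Quotient.sound ⟨hN.toFGProjEquiv.trans (e.trans hP.toFGProjEquiv.symm)⟩)

theorem IsFGProjective.kClass_eq_add (hN : IsFGProjective R N) (hP : IsFGProjective R P)
    (hQ : IsFGProjective R Q) (e : N ≃ₗ[R] P × Q) : hN.kClass = hP.kClass + hQ.kClass := by
  unfold IsFGProjective.kClass
  rw [← map_add]
  refine congrArg Algebra.GrothendieckAddGroup.of (Quotient.sound ⟨?_⟩)
  exact hN.toFGProjEquiv.trans
    (e.trans (hP.toFGProjEquiv.symm.prodCongr hQ.toFGProjEquiv.symm))

/-- The kernel of a surjection between finitely generated projective modules is finitely generated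
projective, and classes are additive. -/
theorem IsFGProjective.ker_of_surjective (hP : IsFGProjective R P) (hQ : IsFGProjective R Q)
    (g : P →ₗ[R] Q) (hg : Function.Surjective g) :
    ∃ hk : IsFGProjective R (LinearMap.ker g), hP.kClass = hk.kClass + hQ.kClass := by
  have := hQ.projective
  obtain ⟨s, hs⟩ := Module.projective_lifting_property g LinearMap.id hg
  have hs' : ∀ y, g (s y) = y := fun y => LinearMap.congr_fun hs y
  let r : P →ₗ[R] LinearMap.ker g := (LinearMap.id - s.comp g).codRestrict _ fun x => by
    simp [hs']
  have hr : ∀ x : LinearMap.ker g, r x = x := fun x => Subtype.ext (by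
    change (x : P) - s (g x) = x
    rw [LinearMap.mem_ker.mp x.2, map_zero, sub_zero])
  have hk : IsFGProjective R (LinearMap.ker g) := hP.of_retract (LinearMap.ker g).subtype r hr
  refine ⟨hk, hP.kClass_eq_add hk hQ (LinearEquiv.ofLinearMap (r.prod g)
    ((LinearMap.ker g).subtype.coprod s) ?_ ?_)⟩
  · have hrs : ∀ y, r (s y) = 0 := fun y => Subtype.ext (by
      change s y - s (g (s y)) = 0
      rw [hs', sub_self])
    refine LinearMap.ext fun ⟨x, y⟩ => Prod.ext ?_ ?_
    · simp [hr, hrs]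
    · simp [hs']
  · refine LinearMap.ext fun x => ?_
    change x - s (g x) + s (g x) = x
    abel

end KTheory

/-! ### Comparison of a decomposition with the kernel and a complement of the range. -/

section Fredholm

variable {A : Type u} [CStarAlgebra A] {M : Type v} [NormedAddCommGroup M] [Module A M]
  {F : M →L[A] M}

namespace IsFredholmDecomposition

variable {M₁ N₁ M₂ N₂ : Submodule A M}

theorem apply_mem_M₂ (h : IsFredholmDecomposition F M₁ N₁ M₂ N₂) {x : M} (hx : x ∈ M₁) :
    F x ∈ M₂ := by
  obtain ⟨e, he⟩ := h.isomorphism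
  rw [← he ⟨x, hx⟩]
  exact (e ⟨x, hx⟩).2

theorem le_range (h : IsFredholmDecomposition F M₁ N₁ M₂ N₂) :
    M₂ ≤ LinearMap.range (F : M →ₗ[A] M) := by
  intro y hy
  obtain ⟨e, he⟩ := h.isomorphism
  refine ⟨e.symm ⟨y, hy⟩, ?_⟩
  change F _ = y
  rw [← he, e.apply_symm_apply]

theorem exists_add (h : IsFredholmDecomposition F M₁ N₁ M₂ N₂) (x : M) :
    ∃ m ∈ M₁, ∃ n ∈ N₁, m + n = x :=
  Submodule.mem_sup.mp (h.isCompl_domain.sup_eq_top ▸ Submodule.mem_top)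

/-- A vector whose image lies in `N₂` has no component in `M₁`. -/
theorem apply_eq_zero_of_apply_add_mem (h : IsFredholmDecomposition F M₁ N₁ M₂ N₂) {m n : M}
    (hm : m ∈ M₁) (hn : n ∈ N₁) (hF : F (m + n) ∈ N₂) : m = 0 := by
  have hFm : F m ∈ N₂ := by
    have := N₂.sub_mem hF (h.mapsTo n hn)
    rwa [map_add, add_sub_cancel_right] at this
  have h0 : F m = 0 :=
    Submodule.disjoint_def.mp h.isCompl_codomain.disjoint _ (h.apply_mem_M₂ hm) hFm
  obtain ⟨e, he⟩ := h.isomorphism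
  have : e ⟨m, hm⟩ = 0 := Subtype.ext ((he ⟨m, hm⟩).trans h0)
  exact congrArg Subtype.val (e.map_eq_zero_iff.mp this)

theorem ker_le (h : IsFredholmDecomposition F M₁ N₁ M₂ N₂) :
    LinearMap.ker (F : M →ₗ[A] M) ≤ N₁ := by
  intro x hx
  obtain ⟨m, hm, n, hn, rfl⟩ := h.exists_add x
  have h0 : F (m + n) = 0 := hx
  rw [h.apply_eq_zero_of_apply_add_mem hm hn (h0 ▸ N₂.zero_mem), zero_add]
  exact hn

variable [PartialOrder A] [StarOrderedRing A] [NormedSpace ℂ M] [CStarModule A M]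
  [CompleteSpace M]

theorem isFGProjective_N₁ (h : IsFredholmDecomposition F M₁ N₁ M₂ N₂) : IsFGProjective A N₁ :=
  h.fg_N₁.isFGProjective_of_isClosed h.isClosed_N₁

theorem isFGProjective_N₂ (h : IsFredholmDecomposition F M₁ N₁ M₂ N₂) : IsFGProjective A N₂ :=
  h.fg_N₂.isFGProjective_of_isClosed h.isClosed_N₂

/-- For every complement `C` of the range, `[N₁] - [N₂] = [ker F] - [C]`. -/
theorem exists_kClass_sub_eq (h : IsFredholmDecomposition F M₁ N₁ M₂ N₂) {C : Submodule A M}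
    (hC : IsCompl (LinearMap.range (F : M →ₗ[A] M)) C) :
    ∃ (hker : IsFGProjective A (LinearMap.ker (F : M →ₗ[A] M))) (hcoker : IsFGProjective A C),
      h.isFGProjective_N₁.kClass - h.isFGProjective_N₂.kClass =
        hker.kClass - hcoker.kClass := by
  let p : N₂ →ₗ[A] C := (C.projectionOnto _ hC.symm).comp N₂.subtype
  let s : C →ₗ[A] N₂ := (N₂.projectionOnto _ h.isCompl_codomain.symm).comp C.subtype
  -- `y - s y` lies in `M₂ ≤ Im F`, which the projection onto `C` kills.
  have hps : ∀ y, p (s y) = y := by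
    intro y
    have h1 : (y : M) - s y ∈ M₂ := by
      rw [← Submodule.projectionOnto_apply_eq_zero_iff h.isCompl_codomain.symm, map_sub,
        Submodule.projectionOnto_apply_left]
      exact sub_self _
    have h2 := (Submodule.projectionOnto_apply_eq_zero_iff hC.symm).mpr (h.le_range h1)
    rw [map_sub, Submodule.projectionOnto_apply_left] at h2
    exact (sub_eq_zero.mp h2).symm
  have hcoker : IsFGProjective A C := h.isFGProjective_N₂.of_retract s p hps
  obtain ⟨hkp, hN₂⟩ :=
    h.isFGProjective_N₂.ker_of_surjective hcoker p fun y => ⟨s y, hps y⟩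
  have hmem : ∀ y : N₂, y ∈ LinearMap.ker p ↔ (y : M) ∈ LinearMap.range (F : M →ₗ[A] M) :=
    fun y => Submodule.projectionOnto_apply_eq_zero_iff hC.symm
  -- `ker p` is `N₂ ∩ Im F`. If `F (m + n) ∈ N₂` then `m = 0`, so `N₁` already covers it.
  let g : N₁ →ₗ[A] LinearMap.ker p :=
    (((F : M →ₗ[A] M).restrict h.mapsTo)).codRestrict _ fun x => (hmem _).mpr ⟨x, rfl⟩
  have hg : Function.Surjective g := by
    rintro ⟨⟨y, hy⟩, hyp⟩
    obtain ⟨x, rfl⟩ := (hmem _).mp hyp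
    obtain ⟨m, hm, n, hn, rfl⟩ := h.exists_add x
    refine ⟨⟨n, hn⟩, Subtype.ext (Subtype.ext ?_)⟩
    change F n = F (m + n)
    rw [h.apply_eq_zero_of_apply_add_mem hm hn hy, zero_add]
  obtain ⟨hkg, hN₁⟩ := h.isFGProjective_N₁.ker_of_surjective hkp g hg
  have hgF : ∀ x : N₁, x ∈ LinearMap.ker g ↔ (x : M) ∈ LinearMap.ker (F : M →ₗ[A] M) := by
    intro x
    rw [LinearMap.mem_ker, LinearMap.mem_ker, Subtype.ext_iff, Subtype.ext_iff]
    rfl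
  let e : LinearMap.ker g ≃ₗ[A] LinearMap.ker (F : M →ₗ[A] M) :=
    { toFun := fun x => ⟨x.1, (hgF _).mp x.2⟩
      invFun := fun x => ⟨⟨x, h.ker_le x.2⟩, (hgF _).mpr x.2⟩
      map_add' := fun _ _ => rfl
      map_smul' := fun _ _ => rfl }
  have hker : IsFGProjective A (LinearMap.ker (F : M →ₗ[A] M)) :=
    hkg.of_retract e.symm.toLinearMap e.toLinearMap e.apply_symm_apply
  refine ⟨hker, hcoker, ?_⟩
  rw [hN₁, hN₂, hkg.kClass_congr hker e]
  abel

end IsFredholmDecomposition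

end Fredholm

theorem mainTheorem12 {A : Type u} [CStarAlgebra A] [PartialOrder A] [StarOrderedRing A]
    {M : Type v} [NormedAddCommGroup M] [NormedSpace ℂ M] [Module A M] [CStarModule A M]
    [CompleteSpace M] (F : M →L[A] M) (hF : IsAFredholm F)
    (hclosed : IsClosed (Set.range F)) :
    ∃ (hker : IsFGProjective A (LinearMap.ker (F : M →ₗ[A] M)))
      (hcoker : IsFGProjective A (hilbertOrthogonal (LinearMap.range (F : M →ₗ[A] M)))),
      (∀ M₁ N₁ M₂ N₂ : Submodule A M, IsFredholmDecomposition F M₁ N₁ M₂ N₂ →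
        ∃ (h₁ : IsFGProjective A N₁) (h₂ : IsFGProjective A N₂),
          h₁.kClass - h₂.kClass = hker.kClass - hcoker.kClass) ∧
      (∃! κ : KZero A, IsFredholmIndex F κ) ∧
      IsFredholmIndex F (hker.kClass - hcoker.kClass) := by
  obtain ⟨⟨G, hG⟩, M₁, N₁, M₂, N₂, hdec⟩ := hF
  have hC := CStarModule.isCompl_range_hilbertOrthogonal
    (T := (F : M →ₗ[A] M)) (T' := (G : M →ₗ[A] M)) hG hclosed
  obtain ⟨hker, hcoker, hindex⟩ := hdec.exists_kClass_sub_eq hC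
  have hF' : IsFredholmIndex F (hker.kClass - hcoker.kClass) :=
    ⟨M₁, N₁, M₂, N₂, hdec, hdec.isFGProjective_N₁, hdec.isFGProjective_N₂, hindex.symm⟩
  refine ⟨hker, hcoker, fun _ _ _ _ h => ?_, ⟨_, hF', ?_⟩, hF'⟩
  · obtain ⟨_, _, hκ⟩ := h.exists_kClass_sub_eq hC
    exact ⟨h.isFGProjective_N₁, h.isFGProjective_N₂, hκ⟩
  · rintro _ ⟨_, _, _, _, h, _, _, rfl⟩
    obtain ⟨_, _, hκ⟩ := h.exists_kClass_sub_eq hC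
    exact hκ
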